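/- For a normed space $X$ and $n\in\mathbb N$, let $\mathrm{Aff}_n(X)$ be the set of all affine subspaces $c+W_0$ of $X$ ($c\in X$, $W_0$ a linear subspace, $\dim W_0\le n$), and for $K\subset X$ let $$d_n(K)_X=\inf_{W\in \mathrm{Aff}_n(X)}\ \sup_{x\in K}\ \inf_{\xi\in W}\|x-\xi\|_X$$ be the affine Kolmogorov $n$-width of $K$. **Theorem.** Let $H$ be a real or complex Hilbert space, let $A:D(A)\to H$ be the infinitesimal generator of a $C_0$-semigroup $\{e^{tA}\}_{t\ge0}$ of bounded linear operators on $H$ with $\|e^{tA}\|\le Me^{\omega t}$ for all $t\ge 0$, where $M\ge1$ and $\omega\in\mathbb R$ are constants, let $B:H\to H$ be a bounded linear operator, and let $T>0$ and $x_0\in H$. Let $K$ be a nonempty subset of the real space $L^2(0,T)$ such that $\|u\|_{L^2(0,T)}\le r$ for each $u\in K$, and assume $M\|B\|\sqrt T\,r<1$. Let $\mathcal R_T(x_0)\subset H$ be the reachable set, i.e. the set of all endpoints $x(T)$ of (mild) solutions of $$\dot x(t)=(A+u(t)B)x(t),\quad t\in[0,T],\qquad x(0)=x_0,$$ with $u\in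 K$; here a solution is a continuous function $x:[0,T]\to H$ with $x(t)=e^{tA}x_0+\int_0^t e^{(t-s)A}u(s)Bx(s)\,ds$ for all $t\in[0,T]$. Then, for each $n\in\mathbb N$, $$d_n(\mathcal R_T(x_0))_H\ \le\ M^2\|B\|\,\|x_0\|\sqrt T\,e^{\omega T}\,d_n(K)_{L^2(0,T)}+\frac{M^3\|B\|^2\|x_0\|\,T\,e^{\omega T}\,r^2}{1-M\|B\|\sqrt T\,r}.$$ -/

import Mathlib

open Filter Topology MeasureTheory
open scoped ENNReal

/-- The set `Aff_n(X)` of all (nonempty) affine subspaces of dimension at most `n`. -/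
def Aff (𝕜 : Type*) {X : Type*} [RCLike 𝕜] [NormedAddCommGroup X] [NormedSpace 𝕜 X]
    (n : ℕ) : Set (AffineSubspace 𝕜 X) :=
  {W | (W : Set X).Nonempty ∧ Module.rank 𝕜 W.direction ≤ n}

/-- The affine Kolmogorov `n`-width
`d_n(K)_X = inf_{W ∈ Aff_n(X)} sup_{x ∈ K} inf_{ξ ∈ W} ‖x - ξ‖`.
It is taken in `[0, ∞]`, so that no infimum or supremum has a default value. -/
noncomputable def affineWidth (𝕜 : Type*) {X : Type*} [RCLike 𝕜] [NormedAddCommGroup X]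
    [NormedSpace 𝕜 X] (n : ℕ) (K : Set X) : ℝ≥0∞ :=
  ⨅ W ∈ Aff 𝕜 (X := X) n, ⨆ x ∈ K, ⨅ ξ ∈ W, ‖x - ξ‖ₑ

/-- `S` is a `C₀`-semigroup of bounded linear operators. Only the values `S t` with `0 ≤ t`
are meaningful. -/
structure IsC0Semigroup {𝕜 H : Type*} [RCLike 𝕜] [NormedAddCommGroup H] [NormedSpace 𝕜 H]
    (S : ℝ → H →L[𝕜] H) : Prop where
  zero : S 0 = ContinuousLinearMap.id 𝕜 H
  add : ∀ s t : ℝ, 0 ≤ s → 0 ≤ t → S (s + t) = (S s).comp (S t)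
  tendsto : ∀ x : H, Tendsto (fun t : ℝ => S t x) (𝓝[>] 0) (𝓝 x)

/-- `A` (with its domain) is the infinitesimal generator of `S`: the domain consists of all `x`
for which the limit of `(S t x - x) / t` as `t → 0+` exists, and `A x` is this limit. -/
structure IsInfinitesimalGenerator {𝕜 H : Type*} [RCLike 𝕜] [NormedAddCommGroup H]
    [NormedSpace 𝕜 H] [NormedSpace ℝ H] (A : H →ₗ.[𝕜] H) (S : ℝ → H →L[𝕜] H) : Prop where
  mem_domain_iff : ∀ x : H, x ∈ A.domain ↔
    ∃ y : H, Tendsto (fun t : ℝ => t⁻¹ • (S t x - x)) (𝓝[>] 0) (𝓝 y)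
  tendsto : ∀ x : A.domain,
    Tendsto (fun t : ℝ => t⁻¹ • (S t (x : H) - (x : H))) (𝓝[>] 0) (𝓝 (A x))

/-- The real Hilbert space `L²(0, T)` of controls. -/
abbrev ControlSpace (T : ℝ) : Type := Lp ℝ 2 (volume.restrict (Set.Ioo 0 T))

/-- `x` is a (mild) solution on `[0, T]` of `ẋ(t) = (A + u(t) B) x(t)`, `x(0) = x₀`, where `A`
generates the semigroup `S`: it is continuous and satisfies the variation of constants formula
`x(t) = e^{tA} x₀ + ∫₀ᵗ e^{(t-s)A} u(s) B x(s) ds`. -/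
structure IsMildSolution {𝕜 H : Type*} [RCLike 𝕜] [NormedAddCommGroup H] [NormedSpace 𝕜 H]
    [NormedSpace ℝ H] (S : ℝ → H →L[𝕜] H) (B : H →L[𝕜] H) (T : ℝ) (u : ControlSpace T)
    (x₀ : H) (x : ℝ → H) : Prop where
  continuousOn : ContinuousOn x (Set.Icc 0 T)
  eq : ∀ t ∈ Set.Icc 0 T, x t = S t x₀ + ∫ s in (0 : ℝ)..t, S (t - s) (u s • B (x s))

/-- The reachable set `R_T(x₀)`: all endpoints `x(T)` of solutions with `x(0) = x₀` and a control
in `K`. -/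
def reachableSet {𝕜 H : Type*} [RCLike 𝕜] [NormedAddCommGroup H] [NormedSpace 𝕜 H]
    [NormedSpace ℝ H] (S : ℝ → H →L[𝕜] H) (B : H →L[𝕜] H) (T : ℝ)
    (K : Set (ControlSpace T)) (x₀ : H) : Set H :=
  {y | ∃ u ∈ K, ∃ x : ℝ → H, IsMildSolution S B T u x₀ x ∧ x T = y}

/-!
To first order in the control, the endpoint of a mild solution is the affine function
`S(T) x₀ + L u`, where `L u = ∫₀ᵀ S(T-s) u(s) B S(s) x₀ ds` is the Duhamel integral along the free
motion. An affine space `W` of controls is mapped into an affine subspace of `H` of no larger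
dimension, so the width of the reachable set is at most `‖L‖ d_n(K)` plus the distance of the
endpoints from their first-order approximations (`affineWidth_le_of_affine_approx`). If `H` is
complex, `L` is only real-linear on the real space of controls, and the complex span of the image
is used.

All constants come from one estimate of Duhamel integrals in the weighted norm
`e^{-ωt} ‖·‖` (`norm_duhamel_le`), in which the semigroup costs a factor `M` only. Along the free
motion it bounds `L`; along the solution it gives `Z ≤ M ‖x₀‖ + q Z` for the weighted supremum `Z`
of the solution, with `q = M ‖B‖ √T r < 1` (`IsMildSolution.norm_le`). The remainder
`x(T) - S(T) x₀ - L u` is the Duhamel integral along `x - S(·) x₀`, which is itself a Duhamel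
integral along `x`; the estimate is applied twice and gives `q² Z`.

Strong continuity of the semigroup makes the integrands integrable, without which neither the
linearity of `L` nor the formula for the remainder would hold for Bochner integrals.
-/

/-! ### Kolmogorov widths under approximation by an affine map -/

/-- A bound that holds for all values of a nonempty family passes to the infimum, also when the
factor `a` is `0` and the infimum is `∞`. -/
theorem le_mul_iInf_add {ι : Type*} [Nonempty ι] {f : ι → ℝ≥0∞} {x a b : ℝ≥0∞} (ha : a ≠ ∞)
    (h : ∀ i, x ≤ a * f i + b) : x ≤ a * (⨅ i, f i) + b := by
  rw [ENNReal.mul_iInf (fun h' => absurd h' ha), ENNReal.iInf_add]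
  exact le_iInf h

/-- A real-linear map does not increase dimension, even if the `𝕜`-span of its range is taken. -/
theorem rank_span_image_le {𝕜 X H : Type*} [RCLike 𝕜] [AddCommGroup X] [Module ℝ X]
    [AddCommGroup H] [Module 𝕜 H] [Module ℝ H] [IsScalarTower ℝ 𝕜 H]
    (L : X →ₗ[ℝ] H) (D : Submodule ℝ X) {n : ℕ} (hD : Module.rank ℝ D ≤ n) :
    Module.rank 𝕜 (Submodule.span 𝕜 (L '' (D : Set X))) ≤ n := by
  let b := Module.Basis.ofVectorSpace ℝ D
  have hb : Submodule.span ℝ (Set.range fun i => (b i : X)) = D := by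
    have h := congrArg (Submodule.map D.subtype) b.span_eq
    rw [Submodule.map_span, ← Set.range_comp, Submodule.map_top, Submodule.range_subtype] at h
    exact h
  have hL : L '' (D : Set X) = Submodule.span ℝ (Set.range fun i => L (b i : X)) := by
    have h := congrArg (Submodule.map L) hb
    rw [Submodule.map_span, ← Set.range_comp] at h
    rw [← Submodule.map_coe, ← h]
    rfl
  rw [hL, Submodule.span_span_of_tower]
  refine (rank_span_le _).trans ?_
  have h := Cardinal.mk_range_le_lift (f := fun i => L (b i : X))
  rw [b.mk_eq_rank''] at h
  have h2 := h.trans (Cardinal.lift_le.2 hD)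
  rw [Cardinal.lift_natCast] at h2
  simpa using h2

/-- Kolmogorov widths under approximation by an affine image: if every point of `R` is within `b`
of `c + L u` for some `u ∈ K`, where `‖L v‖ ≤ a ‖v‖`, then `d_n(R) ≤ a d_n(K) + b`. The set `K`
lives in a real space while `R` may lie in a complex one. -/
theorem affineWidth_le_of_affine_approx {𝕜 X H : Type*} [RCLike 𝕜] [NormedAddCommGroup X]
    [NormedSpace ℝ X] [NormedAddCommGroup H] [NormedSpace 𝕜 H] [NormedSpace ℝ H]
    [IsScalarTower ℝ 𝕜 H] {K : Set X} {R : Set H} (L : X →ₗ[ℝ] H) (c : H) {a b : ℝ}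
    (ha : 0 ≤ a) (hb : 0 ≤ b) (hL : ∀ v, ‖L v‖ ≤ a * ‖v‖)
    (hR : ∀ y ∈ R, ∃ u ∈ K, ‖y - (c + L u)‖ ≤ b) (n : ℕ) :
    affineWidth 𝕜 n R ≤ ENNReal.ofReal a * affineWidth ℝ n K + ENNReal.ofReal b := by
  have hne : Nonempty (Aff ℝ (X := X) n) :=
    ⟨⟨AffineSubspace.mk' 0 ⊥, AffineSubspace.mk'_nonempty _ _, by
      rw [AffineSubspace.direction_mk', rank_bot]; exact zero_le⟩⟩
  unfold affineWidth
  rw [iInf_subtype' (p := fun W => W ∈ Aff ℝ (X := X) n)]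
  refine le_mul_iInf_add ENNReal.ofReal_ne_top ?_
  rintro ⟨W, ⟨w₀, hw₀⟩, hW⟩
  refine iInf₂_le_of_le (AffineSubspace.mk' (c + L w₀)
    (Submodule.span 𝕜 (L '' (W.direction : Set X)))) ⟨AffineSubspace.mk'_nonempty _ _, ?_⟩ ?_
  · rw [AffineSubspace.direction_mk']
    exact rank_span_image_le L _ hW
  refine iSup₂_le fun y hy => ?_
  obtain ⟨u, hu, huy⟩ := hR y hy
  have hWne : Nonempty W := ⟨⟨w₀, hw₀⟩⟩
  have key : (⨅ ξ ∈ AffineSubspace.mk' (c + L w₀)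
      (Submodule.span 𝕜 (L '' (W.direction : Set X))), ‖y - ξ‖ₑ) ≤
      ENNReal.ofReal a * (⨅ ξ : W, ‖u - ξ‖ₑ) + ENNReal.ofReal b := by
    refine le_mul_iInf_add ENNReal.ofReal_ne_top ?_
    rintro ⟨η, hη⟩
    refine iInf₂_le_of_le (c + L η) ?_ ?_
    · rw [AffineSubspace.mem_mk']
      refine Submodule.subset_span ⟨η - w₀, AffineSubspace.vsub_mem_direction hη hw₀, ?_⟩
      simp [vsub_eq_sub]
    · have h : ‖y - (c + L η)‖ ≤ a * ‖u - η‖ + b := by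
        calc ‖y - (c + L η)‖ = ‖L (u - η) + (y - (c + L u))‖ := by
              congr 1; rw [map_sub]; abel
          _ ≤ _ := (norm_add_le _ _).trans (add_le_add (hL _) huy)
      rw [← ofReal_norm, ← ofReal_norm, ← ENNReal.ofReal_mul ha,
        ← ENNReal.ofReal_add (by positivity) hb]
      exact ENNReal.ofReal_le_ofReal h
  refine key.trans (add_le_add_left (mul_le_mul_right ?_ _) _)
  refine (iInf_subtype' (p := fun ξ => ξ ∈ W) (f := fun ξ _ => ‖u - ξ‖ₑ)).ge.trans ?_
  exact le_iSup₂ (f := fun x (_ : x ∈ K) => ⨅ ξ ∈ W, ‖x - ξ‖ₑ) u hu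

/-! ### Controls and semigroups -/

theorem ControlSpace.intervalIntegrable {T : ℝ} (u : ControlSpace T) {t : ℝ}
    (ht : t ∈ Set.Icc 0 T) : IntervalIntegrable u volume 0 t := by
  have h : Integrable u (volume.restrict (Set.Ioo 0 T)) := (Lp.memLp u).integrable (by norm_num)
  rw [intervalIntegrable_iff_integrableOn_Ioo_of_le ht.1]
  exact IntegrableOn.mono_set h (Set.Ioo_subset_Ioo_right ht.2)

/-- Cauchy–Schwarz on `(0, T)`, applied to `|u|` and the constant `1`. -/
theorem ControlSpace.integral_abs_le {T : ℝ} (u : ControlSpace T) {t : ℝ}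
    (ht : t ∈ Set.Icc 0 T) : ∫ s in (0 : ℝ)..t, |u s| ≤ √T * ‖u‖ := by
  have h0 : Integrable u (volume.restrict (Set.Ioo 0 T)) := (Lp.memLp u).integrable (by norm_num)
  have h1 : ∫ s in (0 : ℝ)..t, |u s| ≤ ∫ s in Set.Ioo 0 T, ‖u s‖ := by
    rw [intervalIntegral.integral_of_le ht.1, integral_Ioc_eq_integral_Ioo]
    refine setIntegral_mono_set h0.norm (Eventually.of_forall fun s => norm_nonneg (u s))
      (Set.Ioo_subset_Ioo_right ht.2).eventuallyLE
  refine h1.trans ?_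
  have h2 := eLpNorm_le_eLpNorm_mul_rpow_measure_univ (p := 1) (q := 2) (by norm_num)
    (Lp.aestronglyMeasurable u)
  rw [integral_norm_eq_lintegral_enorm h0.1, ← eLpNorm_one_eq_lintegral_enorm, Lp.norm_def]
  have h3 := ENNReal.toReal_mono (ENNReal.mul_ne_top (Lp.eLpNorm_ne_top u)
    (ENNReal.rpow_ne_top_of_nonneg (by norm_num) (measure_ne_top _ _))) h2
  refine h3.trans_eq ?_
  rw [ENNReal.toReal_mul, mul_comm]
  congr 1
  simp [← ENNReal.toReal_rpow, ht.1.trans ht.2, Real.sqrt_eq_rpow]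
  norm_num

section Semigroup

variable {𝕜 H : Type*} [RCLike 𝕜] [NormedAddCommGroup H] [NormedSpace 𝕜 H]
  {S : ℝ → H →L[𝕜] H}

theorem IsC0Semigroup.norm_sub_le (hS : IsC0Semigroup S) {T C : ℝ}
    (hC : ∀ t ∈ Set.Icc 0 T, ‖S t‖ ≤ C) (v : H) {s t : ℝ} (hs : s ∈ Set.Icc 0 T)
    (ht : t ∈ Set.Icc 0 T) : ‖S t v - S s v‖ ≤ C * ‖S |t - s| v - v‖ := by
  wlog hst : s ≤ t generalizing s t
  · rw [norm_sub_rev, abs_sub_comm]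
    exact this ht hs (le_of_not_ge hst)
  have h : S t v - S s v = S s (S |t - s| v - v) := by
    rw [map_sub, abs_of_nonneg (sub_nonneg.2 hst), ← ContinuousLinearMap.comp_apply,
      ← hS.add _ _ hs.1 (sub_nonneg.2 hst), add_sub_cancel]
  rw [h]
  exact (S s).le_of_opNorm_le (hC s hs) _

theorem IsC0Semigroup.continuousOn (hS : IsC0Semigroup S) {T C : ℝ}
    (hC : ∀ t ∈ Set.Icc 0 T, ‖S t‖ ≤ C) (v : H) :
    ContinuousOn (fun t => S t v) (Set.Icc 0 T) := by
  intro s hs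
  rw [ContinuousWithinAt, tendsto_iff_norm_sub_tendsto_zero]
  have h0 : Tendsto (fun h => S h v) (𝓝[≥] 0) (𝓝 v) := by
    rw [← Set.Ioi_insert, nhdsWithin_insert, tendsto_sup]
    refine ⟨?_, hS.tendsto v⟩
    rw [tendsto_pure_left]
    intro U hU
    simpa [hS.zero] using mem_of_mem_nhds hU
  have h1 : Tendsto (fun t => |t - s|) (𝓝[Set.Icc 0 T] s) (𝓝[≥] 0) := by
    refine tendsto_nhdsWithin_iff.2 ⟨?_, Eventually.of_forall fun t => abs_nonneg (t - s)⟩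
    have : ContinuousAt (fun t => |t - s|) s := by fun_prop
    simpa [ContinuousAt] using this.tendsto.mono_left nhdsWithin_le_nhds
  have h2 := ((tendsto_iff_norm_sub_tendsto_zero.1 (h0.comp h1))).const_mul C
  rw [mul_zero] at h2
  refine squeeze_zero' (Eventually.of_forall fun t => norm_nonneg _) ?_ h2
  filter_upwards [self_mem_nhdsWithin] with t ht
  exact hS.norm_sub_le hC v hs ht

/-- Strong continuity together with local boundedness gives joint continuity. -/
theorem IsC0Semigroup.continuousOn_apply (hS : IsC0Semigroup S) {T C : ℝ}
    (hC : ∀ t ∈ Set.Icc 0 T, ‖S t‖ ≤ C) {t : ℝ} (ht : t ∈ Set.Icc 0 T) {f : ℝ → H}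
    (hf : ContinuousOn f (Set.Icc 0 t)) :
    ContinuousOn (fun s => S (t - s) (f s)) (Set.Icc 0 t) := by
  have hmaps : Set.MapsTo (fun s => t - s) (Set.Icc 0 t) (Set.Icc 0 T) := fun s hs =>
    ⟨sub_nonneg.2 hs.2, by linarith [hs.1, ht.2]⟩
  intro s hs
  have h1 : Tendsto (fun r => S (t - r) (f s)) (𝓝[Set.Icc 0 t] s) (𝓝 (S (t - s) (f s))) :=
    (hS.continuousOn hC (f s)).comp (by fun_prop) hmaps s hs
  have h2 : Tendsto (fun r => S (t - r) (f r - f s)) (𝓝[Set.Icc 0 t] s) (𝓝 0) := by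
    have h3 := (tendsto_iff_norm_sub_tendsto_zero.1 (hf s hs)).const_mul C
    rw [mul_zero] at h3
    refine squeeze_zero_norm' ?_ h3
    filter_upwards [self_mem_nhdsWithin] with r hr
    exact (S (t - r)).le_of_opNorm_le (hC _ (hmaps hr)) _
  have h4 := h1.add h2
  rw [add_zero] at h4
  exact h4.congr fun r => by rw [← map_add, add_sub_cancel]

/-! ### Duhamel integrals and mild solutions -/

variable [NormedSpace ℝ H]

/-- The bound on Duhamel integrals in the norms weighted by `e^{ωt}`. It carries no factor from
the exponentials because `e^{ω(t-s)} e^{ωs} = e^{ωt}`, and needs no measurability of `f`. -/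
theorem norm_duhamel_le {M ω T Z : ℝ} (hM : 0 ≤ M) (hZ : 0 ≤ Z)
    (hbound : ∀ t : ℝ, 0 ≤ t → ‖S t‖ ≤ M * Real.exp (ω * t)) (B : H →L[𝕜] H)
    (u : ControlSpace T) {f : ℝ → H} (hf : ∀ s ∈ Set.Icc 0 T, ‖f s‖ ≤ Real.exp (ω * s) * Z)
    {t : ℝ} (ht : t ∈ Set.Icc 0 T) :
    ‖∫ s in (0 : ℝ)..t, S (t - s) (u s • B (f s))‖ ≤
      Real.exp (ω * t) * (M * ‖B‖ * √T * ‖u‖ * Z) := by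
  have hb : ∀ s ∈ Set.Ioc 0 t, ‖S (t - s) (u s • B (f s))‖ ≤
      M * Real.exp (ω * t) * ‖B‖ * Z * |u s| := by
    intro s hs
    have h1 : ‖u s • B (f s)‖ ≤ |u s| * (‖B‖ * (Real.exp (ω * s) * Z)) := by
      rw [norm_smul, Real.norm_eq_abs]
      gcongr
      exact B.le_of_opNorm_le_of_le le_rfl (hf s ⟨hs.1.le, hs.2.trans ht.2⟩)
    have h2 := (S (t - s)).le_of_opNorm_le_of_le (hbound _ (sub_nonneg.2 hs.2)) h1
    refine h2.trans_eq ?_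
    have h3 : Real.exp (ω * t) = Real.exp (ω * (t - s)) * Real.exp (ω * s) := by
      rw [← Real.exp_add]; ring_nf
    rw [h3]; ring
  have h := intervalIntegral.norm_integral_le_of_norm_le ht.1
    (Eventually.of_forall fun s => hb s) ((u.intervalIntegrable ht).abs.const_mul _)
  rw [intervalIntegral.integral_const_mul] at h
  refine h.trans ?_
  calc _ ≤ M * Real.exp (ω * t) * ‖B‖ * Z * (√T * ‖u‖) := by
        gcongr
        exact u.integral_abs_le ht
    _ = _ := by ring

/-- A priori bound: the weighted supremum `Z` of a mild solution satisfies
`Z ≤ M ‖x₀‖ + q Z` with `q = M ‖B‖ √T r < 1`. -/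
theorem IsMildSolution.norm_le {M ω T r : ℝ} (hM : 0 ≤ M) (hT : 0 ≤ T)
    (hbound : ∀ t : ℝ, 0 ≤ t → ‖S t‖ ≤ M * Real.exp (ω * t)) {B : H →L[𝕜] H}
    (hsmall : M * ‖B‖ * √T * r < 1) {u : ControlSpace T} (hu : ‖u‖ ≤ r) {x₀ : H} {x : ℝ → H}
    (hx : IsMildSolution S B T u x₀ x) :
    ∀ t ∈ Set.Icc 0 T,
      ‖x t‖ ≤ Real.exp (ω * t) * (M * ‖x₀‖ / (1 - M * ‖B‖ * √T * r)) := by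
  obtain ⟨τ, hτ, hmax⟩ := isCompact_Icc.exists_isMaxOn (Set.nonempty_Icc.2 hT)
    (f := fun t => Real.exp (-(ω * t)) * ‖x t‖)
    ((by fun_prop : Continuous fun t => Real.exp (-(ω * t))).continuousOn.mul
      hx.continuousOn.norm)
  set Z := Real.exp (-(ω * τ)) * ‖x τ‖ with hZdef
  have hZ : 0 ≤ Z := by positivity
  have hxZ : ∀ t ∈ Set.Icc 0 T, ‖x t‖ ≤ Real.exp (ω * t) * Z := by
    intro t ht
    have h : Real.exp (-(ω * t)) * ‖x t‖ ≤ Z := hmax ht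
    rw [Real.exp_neg, inv_mul_le_iff₀ (Real.exp_pos _)] at h
    exact h
  have hle : Z ≤ M * ‖x₀‖ + M * ‖B‖ * √T * r * Z := by
    rw [hZdef, Real.exp_neg, inv_mul_le_iff₀ (Real.exp_pos _), ← Real.exp_neg, ← hZdef, hx.eq τ hτ]
    refine (norm_add_le _ _).trans ?_
    rw [mul_add]
    refine add_le_add ?_ ((norm_duhamel_le hM hZ hbound B u hxZ hτ).trans (by gcongr))
    refine ((S τ).le_of_opNorm_le (hbound τ hτ.1) x₀).trans_eq (by ring)
  intro t ht
  refine (hxZ t ht).trans ?_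
  gcongr
  rw [le_div_iff₀ (by linarith)]
  linarith

variable [IsScalarTower ℝ 𝕜 H]

theorem IsC0Semigroup.duhamel_intervalIntegrable (hS : IsC0Semigroup S) {T C : ℝ}
    (hC : ∀ t ∈ Set.Icc 0 T, ‖S t‖ ≤ C) (B : H →L[𝕜] H) (u : ControlSpace T) {t : ℝ}
    (ht : t ∈ Set.Icc 0 T) {f : ℝ → H} (hf : ContinuousOn f (Set.Icc 0 t)) :
    IntervalIntegrable (fun s => S (t - s) (u s • B (f s))) volume 0 t := by
  simp only [ContinuousLinearMap.map_smul_of_tower]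
  refine (u.intervalIntegrable ht).smul_continuousOn ?_
  rw [Set.uIcc_of_le ht.1]
  exact hS.continuousOn_apply hC ht (B.continuous.comp_continuousOn hf)

/-- The first-order term `u ↦ ∫₀ᵗ S(t-s) u(s) B f(s) ds` is real-linear in the control. -/
theorem IsC0Semigroup.exists_linearMap_duhamel (hS : IsC0Semigroup S) {T C : ℝ}
    (hC : ∀ t ∈ Set.Icc 0 T, ‖S t‖ ≤ C) (B : H →L[𝕜] H) {t : ℝ}
    (ht : t ∈ Set.Icc 0 T) {f : ℝ → H} (hf : ContinuousOn f (Set.Icc 0 t)) :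
    ∃ L : ControlSpace T →ₗ[ℝ] H, ∀ u : ControlSpace T,
      L u = ∫ s in (0 : ℝ)..t, S (t - s) (u s • B (f s)) := by
  -- Representatives of `Lp` elements obey the algebraic laws only almost everywhere on `(0, T)`.
  have hae : ∀ {p : ℝ → Prop}, (∀ᵐ s ∂volume.restrict (Set.Ioo 0 T), p s) →
      ∀ᵐ s ∂volume.restrict (Set.Ioo 0 t), p s := fun h =>
    ae_mono (Measure.restrict_mono (Set.Ioo_subset_Ioo_right ht.2) le_rfl) h
  refine ⟨{ toFun := fun u => ∫ s in (0 : ℝ)..t, S (t - s) (u s • B (f s)), map_add' := ?_,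
            map_smul' := ?_ }, fun u => rfl⟩
  · intro u v
    rw [← intervalIntegral.integral_add (hS.duhamel_intervalIntegrable hC B u ht hf)
      (hS.duhamel_intervalIntegrable hC B v ht hf)]
    simp only [intervalIntegral.integral_of_le ht.1, integral_Ioc_eq_integral_Ioo]
    refine integral_congr_ae ?_
    filter_upwards [hae (Lp.coeFn_add u v)] with s hs
    rw [hs, Pi.add_apply, add_smul, map_add]
  · intro a u
    rw [RingHom.id_apply, ← intervalIntegral.integral_smul]
    simp only [intervalIntegral.integral_of_le ht.1, integral_Ioc_eq_integral_Ioo]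
    refine integral_congr_ae ?_
    filter_upwards [hae (Lp.coeFn_smul a u)] with s hs
    rw [hs, Pi.smul_apply, smul_assoc, ContinuousLinearMap.map_smul_of_tower]

end Semigroup

/-! ### The width of the reachable set -/

theorem theorem3 {𝕜 H : Type*} [RCLike 𝕜] [NormedAddCommGroup H] [InnerProductSpace 𝕜 H]
    [CompleteSpace H] [NormedSpace ℝ H] [IsScalarTower ℝ 𝕜 H]
    (A : H →ₗ.[𝕜] H) (S : ℝ → H →L[𝕜] H) (hS : IsC0Semigroup S)
    (hA : IsInfinitesimalGenerator A S) (B : H →L[𝕜] H)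
    (M ω : ℝ) (hM : 1 ≤ M) (hbound : ∀ t : ℝ, 0 ≤ t → ‖S t‖ ≤ M * Real.exp (ω * t))
    (T : ℝ) (hT : 0 < T) (x₀ : H)
    (K : Set (ControlSpace T)) (hK : K.Nonempty) (r : ℝ) (hr : ∀ u ∈ K, ‖u‖ ≤ r)
    (hsmall : M * ‖B‖ * √T * r < 1) (n : ℕ) :
    affineWidth 𝕜 n (reachableSet S B T K x₀) ≤
      ENNReal.ofReal (M ^ 2 * ‖B‖ * ‖x₀‖ * √T * Real.exp (ω * T)) * affineWidth ℝ n K +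
        ENNReal.ofReal (M ^ 3 * ‖B‖ ^ 2 * ‖x₀‖ * T * Real.exp (ω * T) * r ^ 2 /
          (1 - M * ‖B‖ * √T * r)) := by
  have hM0 : 0 ≤ M := zero_le_one.trans hM
  have hr0 : 0 ≤ r := let ⟨u, hu⟩ := hK; (norm_nonneg u).trans (hr u hu)
  have hq : 0 < 1 - M * ‖B‖ * √T * r := sub_pos.2 hsmall
  have hC : ∀ t ∈ Set.Icc 0 T, ‖S t‖ ≤ M * Real.exp (|ω| * T) := by
    intro t ht
    refine (hbound t ht.1).trans ?_
    have h : ω * t ≤ |ω| * T := by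
      nlinarith [le_abs_self ω, abs_nonneg ω, ht.1, ht.2, mul_le_mul_of_nonneg_left ht.2 (abs_nonneg ω)]
    gcongr
  have hTT : T ∈ Set.Icc 0 T := ⟨hT.le, le_rfl⟩
  have hfree := hS.continuousOn hC x₀
  obtain ⟨L, hL⟩ := hS.exists_linearMap_duhamel hC B hTT hfree
  refine affineWidth_le_of_affine_approx L (S T x₀) (by positivity) (by positivity) ?_ ?_ n
  · intro v
    rw [hL]
    refine (norm_duhamel_le hM0 (by positivity : 0 ≤ M * ‖x₀‖) hbound B v
      (fun s hs => ?_) hTT).trans_eq (by ring)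
    exact ((S s).le_of_opNorm_le (hbound s hs.1) x₀).trans_eq (by ring)
  · rintro y ⟨u, hu, x, hx, rfl⟩
    refine ⟨u, hu, ?_⟩
    set Z := M * ‖x₀‖ / (1 - M * ‖B‖ * √T * r) with hZdef
    have hZ : 0 ≤ Z := by positivity
    have hxZ := hx.norm_le hM0 hT.le hbound hsmall (hr u hu)
    have hrem : ∀ s ∈ Set.Icc 0 T,
        ‖x s - S s x₀‖ ≤ Real.exp (ω * s) * (M * ‖B‖ * √T * r * Z) := by
      intro s hs
      rw [hx.eq s hs, add_sub_cancel_left]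
      refine (norm_duhamel_le hM0 hZ hbound B u hxZ hs).trans ?_
      gcongr
      exact hr u hu
    have heq : x T - (S T x₀ + L u) =
        ∫ s in (0 : ℝ)..T, S (T - s) (u s • B (x s - S s x₀)) := by
      rw [hL, hx.eq T hTT, add_sub_add_left_eq_sub, ← intervalIntegral.integral_sub
        (hS.duhamel_intervalIntegrable hC B u hTT hx.continuousOn)
        (hS.duhamel_intervalIntegrable hC B u hTT hfree)]
      simp only [map_sub, smul_sub]
    rw [heq]
    refine (norm_duhamel_le hM0 (by positivity) hbound B u hrem hTT).trans ?_
    calc _ ≤ Real.exp (ω * T) * (M * ‖B‖ * √T * r * (M * ‖B‖ * √T * r * Z)) := by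
          gcongr
          exact hr u hu
      _ = M ^ 2 * ‖B‖ ^ 2 * √T ^ 2 * Real.exp (ω * T) * r ^ 2 * Z := by ring
      _ = _ := by rw [Real.sq_sqrt hT.le, hZdef]; ring
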